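/- Theorem. Let $\mathbb{K}$ be $\mathbb{R}$ or $\mathbb{C}$. A pair $(X,Y)$ of Banach spaces over $\mathbb{K}$ is said to have the Bishop--Phelps--Bollobás property (BPBp) for compact operators if for every $\varepsilon>0$ there is $\eta(\varepsilon)>0$ such that, whenever $T\colon X\to Y$ is a compact linear operator with $\|T\|=1$ and $x_0\in X$ satisfies $\|x_0\|=1$ and $\|T x_0\|>1-\eta(\varepsilon)$, there exist a compact linear operator $S\colon X\to Y$ and $x_1\in X$ with $\|x_1\|=1$ such that \[ \|S\|=\|S x_1\|=1,\qquad \|x_0-x_1\|<\varepsilon,\qquad \|S-T\|<\varepsilon . \] Let $X$ be a Banach space over $\mathbb{K}$ whose dual $X^*$ is (linearly) isometrically isomorphic to $\ell_1$, and let $Y$ be a Banach space over $\mathbb{K}$. If the pair $(c_0,Y)$ has the BPBp for compact operators, then the pair $(X,Y)$ has the BPBp for compact operators. Here $\ell_1$ and $c_0$ are the usual Banach spaces of absolutely summable sequences, respectively of sequences converging to $0$, with entries in $\mathbb{K}$. -/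

import Mathlib

/-- The Bishop-Phelps-Bollobás property for compact operators of a pair `(X, Y)` of normed spaces
over `𝕜`. -/
def HasBPBpCompact (𝕜 : Type*) [RCLike 𝕜]
    (X : Type*) [NormedAddCommGroup X] [NormedSpace 𝕜 X]
    (Y : Type*) [NormedAddCommGroup Y] [NormedSpace 𝕜 Y] : Prop :=
  ∀ ε : ℝ, 0 < ε → ∃ η : ℝ, 0 < η ∧
    ∀ T : X →L[𝕜] Y, IsCompactOperator T → ‖T‖ = 1 →
      ∀ x₀ : X, ‖x₀‖ = 1 → 1 - η < ‖T x₀‖ →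
        ∃ S : X →L[𝕜] Y, IsCompactOperator S ∧
          ∃ x₁ : X, ‖x₁‖ = 1 ∧
            ‖S‖ = 1 ∧ ‖S x₁‖ = 1 ∧ ‖x₀ - x₁‖ < ε ∧ ‖S - T‖ < ε

/-- The Banach space `c₀` of scalar sequences tending to zero, with the supremum norm: functions
on the discrete space `ℕ` vanishing at infinity. -/
abbrev CZero (𝕜 : Type*) [RCLike 𝕜] : Type _ := ZeroAtInftyContinuousMap ℕ 𝕜

/-- The Banach space `ℓ₁` of absolutely summable scalar sequences. -/
abbrev EllOne (𝕜 : Type*) [RCLike 𝕜] : Type _ := lp (fun _ : ℕ => 𝕜) 1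

/-!
Identify the dual of `X` with `ℓ₁`, let `e i` be the functionals corresponding to the unit vectors,
and let `R x = (e i x)_{i < n}`, a contraction of `X` into `ℓ∞ⁿ`. Two facts reduce the claim to
`c₀`.

* `EllOneBasis.exists_lift`: `R` maps the closed unit ball of `X` *onto* that of `ℓ∞ⁿ`, and if
  `R x₀` is within `δ` of the target then the preimage can be taken within little more than `δ` of
  `x₀`. In the bidual `ℓ∞` it suffices to change the first `n` coordinates of `x₀`. A
  Hahn–Banach argument (`exists_norm_le_one_approx_of_dual`) brings this down to `X` up to an
  arbitrarily small error in the coordinates, keeping the point in the unit ball, and iterating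
  removes the error.
* `EllOneBasis.exists_norm_sub_sum_le`: a compact `T : X → Y` is within `δ` of an operator
  `x ↦ ∑ i < n, e i x • y i`. Here `y i` is the value of the second adjoint of `T` at the `i`-th
  unit vector of `ℓ∞`, which lies in `Y` by compactness; the sums converge in operator norm because
  the adjoint of `T` maps the unit ball to a totally bounded subset of `ℓ₁`.

Given `T` and `x₀`, the operator `U c = ∑ i < n, c i • y i` on `c₀` has norm at most `1 + δ` by the
lifting property, and `‖U z₀‖` is close to `1` for `z₀ = R x₀`. The property of `(c₀, Y)` yields
`S₀` near `U` attaining its norm at some `w` near `z₀`. Since `z₀` vanishes from `n` on, `w` has an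
entry of modulus one at some `j < n`. Both `S₀` and `w` may depend on coordinates beyond `n`, so `R`
is replaced by the contraction `L : X → c₀` that has the same first `n` coordinates and fills in the
others by `conj (w j) * e j x * w i` (`EllOneBasis.exists_contraction_apply_eq`). If `x₁` in the
unit ball lifts the first `n` coordinates of `w`, then `L x₁ = w`, so `S = S₀ ∘ L` attains its norm
at `x₁`, and `S` is near `U ∘ L`, which is near `T`.
-/

open Filter Topology

/-! ### Helly's theorem in the unit ball -/

/-- A Helly-type theorem. A functional `Φ` on the dual lying in the unit ball of the bidual and at
distance at most `δ` from `x₀` can be approximated, on finitely many elements of the dual, by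
points of the unit ball that are themselves nearly within `δ` of `x₀`. -/
lemma exists_norm_le_one_approx_of_dual {𝕜 X ι : Type*} [RCLike 𝕜] [NormedAddCommGroup X]
    [NormedSpace 𝕜 X] [Fintype ι] (e : ι → StrongDual 𝕜 X) (Φ : StrongDual 𝕜 X →ₗ[𝕜] 𝕜)
    {x₀ : X} {δ : ℝ} (hδ : 0 ≤ δ) (h₁ : ∀ f, ‖Φ f‖ ≤ ‖f‖) (h₂ : ∀ f, ‖Φ f - f x₀‖ ≤ δ * ‖f‖)
    {ε : ℝ} (hε : 0 < ε) :
    ∃ u : X, ‖u‖ ≤ 1 ∧ ‖u - x₀‖ ≤ δ + ε ∧ ∀ i, ‖e i u - Φ (e i)‖ ≤ ε := by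
  classical
  let _ : NormedSpace ℝ X := NormedSpace.restrictScalars ℝ 𝕜 X
  have : IsScalarTower ℝ 𝕜 X := RestrictScalars.isScalarTower ℝ 𝕜 X
  let M : X × X →L[𝕜] X × (ι → 𝕜) :=
    (ContinuousLinearMap.fst 𝕜 X X - (δ : 𝕜) • ContinuousLinearMap.snd 𝕜 X X).prod
      ((ContinuousLinearMap.pi e).comp (ContinuousLinearMap.fst 𝕜 X X))
  let B : Set X := Metric.closedBall 0 1
  let p : X × (ι → 𝕜) := (x₀, fun i => Φ (e i))
  -- the ball of radius `δ` about `x₀` enters through the second variable, scaled by `δ`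
  suffices hp : p ∈ closure (M '' (B ×ˢ B)) by
    obtain ⟨_, ⟨⟨u, v⟩, ⟨hu, hv⟩, rfl⟩, hd⟩ := Metric.mem_closure_iff.1 hp ε hε
    have hu : ‖u‖ ≤ 1 := by simpa [B] using hu
    have hv : ‖v‖ ≤ 1 := by simpa [B] using hv
    rw [Prod.dist_eq, max_lt_iff] at hd
    refine ⟨u, hu, ?_, fun i => ?_⟩
    · have hd1 : ‖x₀ - (u - (δ : 𝕜) • v)‖ < ε := by simpa [M, p, dist_eq_norm] using hd.1
      calc ‖u - x₀‖ = ‖(δ : 𝕜) • v - (x₀ - (u - (δ : 𝕜) • v))‖ := by congr 1; abel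
        _ ≤ ‖(δ : 𝕜) • v‖ + ‖x₀ - (u - (δ : 𝕜) • v)‖ := norm_sub_le _ _
        _ ≤ δ + ε := by
          have : ‖(δ : 𝕜) • v‖ ≤ δ := by
            rw [norm_smul, RCLike.norm_ofReal, abs_of_nonneg hδ]
            exact mul_le_of_le_one_right hδ hv
          linarith
    · have := (dist_le_pi_dist p.2 (M (u, v)).2 i).trans hd.2.le
      rw [dist_comm, dist_eq_norm] at this
      simpa [M, p] using this
  by_contra hp
  have hconv : Convex ℝ (M '' (B ×ˢ B)) :=
    ((convex_closedBall (0 : X) 1).prod (convex_closedBall (0 : X) 1)).is_linear_image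
      (f := M) ⟨M.map_add, fun c x => M.map_smul_of_tower c x⟩
  obtain ⟨F, r, hF, hr⟩ := RCLike.geometric_hahn_banach_closed_point (𝕜 := 𝕜)
    hconv.closure isClosed_closure hp
  let g : StrongDual 𝕜 X := F.comp (ContinuousLinearMap.inl 𝕜 X (ι → 𝕜))
  let c : ι → 𝕜 := fun i => F (0, Pi.single i 1)
  let h : StrongDual 𝕜 X := g + ∑ i, c i • e i
  have hFeq : ∀ a b, F (a, b) = g a + ∑ i, c i * b i := by
    intro a b
    have h1 : ((a, b) : X × (ι → 𝕜)) = (a, 0) + ∑ i, b i • ((0 : X), (Pi.single i 1 : ι → 𝕜)) := by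
      ext j
      · simp [Prod.fst_sum]
      · simp [Prod.snd_sum, Finset.sum_apply, Pi.single_apply]
    rw [h1, map_add, map_sum]
    simp only [map_smul, smul_eq_mul, mul_comm]
    rfl
  have hball : ∀ u v, ‖u‖ ≤ 1 → ‖v‖ ≤ 1 → ‖h u‖ + ‖((δ : 𝕜) • g) v‖ ≤ r := by
    intro u v hu hv
    -- rotate `u` and `v` so that both values become real and of the right sign
    obtain ⟨a, ha, hau⟩ := RCLike.exists_norm_eq_mul_self (h u)
    obtain ⟨b, hb, hbv⟩ := RCLike.exists_norm_eq_mul_self (((δ : 𝕜) • g) v)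
    have hmem : M (a • u, -(b • v)) ∈ closure (M '' (B ×ˢ B)) := by
      refine subset_closure ⟨_, ⟨?_, ?_⟩, rfl⟩
      · simpa [B, norm_smul, ha] using hu
      · simpa [B, norm_smul, hb] using hv
    have hval : F (M (a • u, -(b • v))) = ((‖h u‖ + ‖((δ : 𝕜) • g) v‖ : ℝ) : 𝕜) := by
      have : M (a • u, -(b • v)) = (a • u + (δ : 𝕜) • b • v, fun i => e i (a • u)) := by
        ext <;> simp [M]
      rw [this, hFeq]
      rw [RCLike.ofReal_add, hau, hbv]
      simp only [map_add, map_smul, h, smul_eq_mul, _root_.add_apply,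
        _root_.sum_apply, _root_.smul_apply, mul_add, Finset.mul_sum]
      have : ∀ i, c i * (a * e i u) = a * (c i * e i u) := fun i => by ring
      simp only [this]
      ring
    have := hF _ hmem
    rw [hval, RCLike.ofReal_re] at this
    exact this.le
  have hnorm : ‖h‖ + δ * ‖g‖ ≤ r := by
    have h3 : ∀ v, ‖v‖ ≤ 1 → ‖h‖ ≤ r - ‖((δ : 𝕜) • g) v‖ := fun v hv =>
      ContinuousLinearMap.opNorm_le_of_unit_norm
        (by have := hball 0 v (by simp) hv; simp at this ⊢; linarith)
        fun u hu => by linarith [hball u v hu.le hv]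
    have h4 : ‖(δ : 𝕜) • g‖ ≤ r - ‖h‖ :=
      ContinuousLinearMap.opNorm_le_of_unit_norm
        (by have := h3 0 (by simp); simp at this; linarith)
        fun v hv => by linarith [h3 v hv.le]
    rw [norm_smul, RCLike.norm_ofReal, abs_of_nonneg hδ] at h4
    linarith
  have hFp : F p = Φ h - (Φ g - g x₀) := by
    simp only [p, hFeq, h, map_add, map_sum, map_smul, smul_eq_mul]
    ring
  have : RCLike.re (F p) ≤ ‖h‖ + δ * ‖g‖ := by
    refine (RCLike.re_le_norm _).trans ?_
    rw [hFp]
    exact (norm_sub_le _ _).trans (add_le_add (h₁ h) (h₂ g))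
  linarith

/-! ### The `ℓ₁` basis of the dual -/

/-- A system `e` of functionals on `X` corresponding to the unit vectors of `ℓ₁` under a linear
isometry of the dual of `X` with `ℓ₁`, together with the coefficient functionals `coef`. -/
structure EllOneBasis (𝕜 X : Type*) [RCLike 𝕜] [NormedAddCommGroup X] [NormedSpace 𝕜 X] where
  /-- The functional corresponding to the `i`-th unit vector. -/
  e : ℕ → StrongDual 𝕜 X
  /-- The `i`-th coefficient of a functional. -/
  coef : ℕ → StrongDual 𝕜 X →ₗ[𝕜] 𝕜
  hasSum_norm : ∀ f, HasSum (fun i => ‖coef i f‖) ‖f‖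
  hasSum : ∀ f, HasSum (fun i => coef i f • e i) f
  coef_e : ∀ i j, coef i (e j) = if i = j then 1 else 0

namespace EllOneBasis

variable {𝕜 X : Type*} [RCLike 𝕜] [NormedAddCommGroup X] [NormedSpace 𝕜 X]

lemma nonempty_of_linearIsometryEquiv (φ : StrongDual 𝕜 X ≃ₗᵢ[𝕜] EllOne 𝕜) :
    Nonempty (EllOneBasis 𝕜 X) := by
  refine ⟨{ e := fun i => φ.symm (lp.single 1 i 1)
            coef := fun i =>
              { toFun := fun f => φ f i
                map_add' := fun f g => by simp
                map_smul' := fun c f => by simp }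
            hasSum_norm := fun f => ?_
            hasSum := fun f => ?_
            coef_e := fun i j => ?_ }⟩
  · have := lp.hasSum_norm (p := 1) (by simp) (φ f)
    simpa using this
  · have h := (lp.hasSum_single (p := 1) (by simp) (φ f)).mapL
      (φ.symm.toContinuousLinearEquiv : EllOne 𝕜 →L[𝕜] StrongDual 𝕜 X)
    simp only [ContinuousLinearEquiv.coe_coe, LinearIsometryEquiv.coe_toContinuousLinearEquiv,
      LinearIsometryEquiv.symm_apply_apply] at h
    have hi : ∀ i, φ f i • φ.symm (lp.single 1 i 1) = φ.symm (lp.single 1 i (φ f i)) := by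
      intro i
      rw [← map_smul, ← lp.single_smul, smul_eq_mul, mul_one]
    simpa only [LinearMap.coe_mk, AddHom.coe_mk, hi] using h
  · simp [Pi.single_apply]

variable (D : EllOneBasis 𝕜 X)

lemma norm_e_le (i : ℕ) : ‖D.e i‖ ≤ 1 := by
  have h := D.hasSum_norm (D.e i)
  have h2 : HasSum (fun j => ‖D.coef j (D.e i)‖) 1 := by
    convert hasSum_ite_eq i (1 : ℝ) using 2 with j
    rw [D.coef_e]; split_ifs <;> simp
  exact (h.unique h2).le

lemma norm_e_apply_le (i : ℕ) (x : X) : ‖D.e i x‖ ≤ ‖x‖ :=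
  (D.e i).le_of_opNorm_le (D.norm_e_le i) x |>.trans_eq (one_mul _)

lemma hasSum_apply (f : StrongDual 𝕜 X) (x : X) :
    HasSum (fun i => D.coef i f * D.e i x) (f x) :=
  (D.hasSum f).mapL (ContinuousLinearMap.apply 𝕜 𝕜 x)

lemma sum_norm_coef_le (f : StrongDual 𝕜 X) (s : Finset ℕ) : ∑ i ∈ s, ‖D.coef i f‖ ≤ ‖f‖ :=
  sum_le_hasSum s (fun _ _ => norm_nonneg _) (D.hasSum_norm f)

/-! ### Lifting finitely many coordinates -/

/-- Finitely many coordinates of a point of the unit ball can be moved by at most `δ`, up to an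
arbitrarily small error, by moving the point by little more than `δ` within the unit ball. -/
lemma exists_approx_lift (n : ℕ) {x₀ : X} (hx₀ : ‖x₀‖ ≤ 1) {z : ℕ → 𝕜} {δ : ℝ} (hδ : 0 ≤ δ)
    (hz : ∀ i < n, ‖z i‖ ≤ 1) (hzx : ∀ i < n, ‖z i - D.e i x₀‖ ≤ δ) {ε : ℝ} (hε : 0 < ε) :
    ∃ u : X, ‖u‖ ≤ 1 ∧ ‖u - x₀‖ ≤ δ + ε ∧ ∀ i < n, ‖z i - D.e i u‖ ≤ ε := by
  -- the point of the bidual `ℓ∞` obtained from `x₀` by replacing the first `n` coordinates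
  let Φ : StrongDual 𝕜 X →ₗ[𝕜] 𝕜 :=
    (ContinuousLinearMap.apply 𝕜 𝕜 x₀ : StrongDual 𝕜 X →L[𝕜] 𝕜).toLinearMap +
      ∑ i ∈ Finset.range n, (z i - D.e i x₀) • D.coef i
  have hΦ : ∀ f, Φ f = f x₀ + ∑ i ∈ Finset.range n, (z i - D.e i x₀) * D.coef i f := by
    intro f; simp [Φ, LinearMap.sum_apply]
  have h₁ : ∀ f, ‖Φ f‖ ≤ ‖f‖ := by
    intro f
    have hs : HasSum (fun i => D.coef i f * D.e i x₀ +
        if i ∈ Finset.range n then (z i - D.e i x₀) * D.coef i f else 0) (Φ f) := by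
      rw [hΦ]
      refine (D.hasSum_apply f x₀).add ?_
      rw [← Finset.sum_congr rfl fun i hi => if_pos hi]
      exact hasSum_sum_of_ne_finset_zero fun i hi => if_neg hi
    refine hs.norm_le_of_bounded (D.hasSum_norm f) fun i => ?_
    split_ifs with hi
    · rw [show D.coef i f * D.e i x₀ + (z i - D.e i x₀) * D.coef i f = D.coef i f * z i by ring,
        norm_mul]
      exact mul_le_of_le_one_right (norm_nonneg _) (hz i (Finset.mem_range.1 hi))
    · rw [add_zero, norm_mul]
      exact mul_le_of_le_one_right (norm_nonneg _) ((D.norm_e_apply_le i x₀).trans hx₀)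
  have h₂ : ∀ f, ‖Φ f - f x₀‖ ≤ δ * ‖f‖ := by
    intro f
    rw [hΦ, add_sub_cancel_left]
    calc _ ≤ ∑ i ∈ Finset.range n, δ * ‖D.coef i f‖ := by
          refine norm_sum_le_of_le _ fun i hi => ?_
          rw [norm_mul]
          exact mul_le_mul_of_nonneg_right (hzx i (Finset.mem_range.1 hi)) (norm_nonneg _)
      _ ≤ δ * ‖f‖ := by
          rw [← Finset.mul_sum]
          exact mul_le_mul_of_nonneg_left (D.sum_norm_coef_le f _) hδ
  obtain ⟨u, hu, hux, hue⟩ := exists_norm_le_one_approx_of_dual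
    (fun i : Fin n => D.e i) Φ hδ h₁ h₂ hε
  refine ⟨u, hu, hux, fun i hi => ?_⟩
  have hΦe : Φ (D.e i) = z i := by
    simp [hΦ, D.coef_e, hi]
  have := hue ⟨i, hi⟩
  rwa [hΦe, norm_sub_rev] at this

/-- The first `n` coordinates map the unit ball of `X` onto that of `ℓ∞ⁿ`, and the lift may be
taken close to a prescribed point with nearby coordinates. -/
lemma exists_lift [CompleteSpace X] (n : ℕ) {x₀ : X} (hx₀ : ‖x₀‖ ≤ 1) {z : ℕ → 𝕜} {δ : ℝ}
    (hδ : 0 ≤ δ) (hz : ∀ i < n, ‖z i‖ ≤ 1) (hzx : ∀ i < n, ‖z i - D.e i x₀‖ ≤ δ)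
    {ρ : ℝ} (hρ : 0 < ρ) :
    ∃ x : X, ‖x‖ ≤ 1 ∧ ‖x - x₀‖ ≤ δ + ρ ∧ ∀ i < n, D.e i x = z i := by
  -- the `k`-th approximation has coordinate errors at most `r k`, and so can be corrected by a step
  -- of length at most `r k + r (k + 1)`; the steps add up to less than `ρ`
  let r : ℕ → ℝ := fun k => ρ / 8 / 2 ^ k
  have hr : ∀ k, 0 < r k := fun k => by positivity
  let P : ℕ → X → Prop := fun k u => ‖u‖ ≤ 1 ∧ ∀ i < n, ‖z i - D.e i u‖ ≤ r k
  have step : ∀ k u, ∃ v, P k u → P (k + 1) v ∧ ‖v - u‖ ≤ r k + r (k + 1) := by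
    intro k u
    by_cases hP : P k u
    · obtain ⟨v, h1, h2, h3⟩ := D.exists_approx_lift n hP.1 (hr k).le hz hP.2 (hr (k + 1))
      exact ⟨v, fun _ => ⟨⟨h1, h3⟩, h2⟩⟩
    · exact ⟨0, fun h => absurd h hP⟩
  choose next hnext using step
  obtain ⟨u₀, h1, h2, h3⟩ := D.exists_approx_lift n hx₀ hδ hz hzx (hr 0)
  let u : ℕ → X := fun k => Nat.rec u₀ (fun k v => next k v) k
  have hu : ∀ k, P k (u k) := by
    intro k
    induction k with
    | zero => exact ⟨h1, h3⟩
    | succ k ih => exact (hnext k (u k) ih).1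
  have hd : ∀ k, dist (u k) (u (k + 1)) ≤ ρ / 2 / 2 / 2 ^ k := by
    intro k
    rw [dist_comm, dist_eq_norm]
    refine (hnext k (u k) (hu k)).2.trans ?_
    have : r (k + 1) ≤ r k := by
      simp only [r]; gcongr <;> simp
    have h8 : ρ / 2 / 2 / 2 ^ k = r k + r k := by simp only [r]; ring
    linarith
  obtain ⟨x, hx⟩ := cauchySeq_tendsto_of_complete (cauchySeq_of_le_geometric_two hd)
  refine ⟨x, ?_, ?_, fun i hi => ?_⟩
  · exact le_of_tendsto' hx.norm fun k => (hu k).1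
  · have h4 := dist_le_of_le_geometric_two_of_tendsto₀ hd hx
    rw [dist_comm, dist_eq_norm] at h4
    have h5 : r 0 = ρ / 8 := by simp [r]
    calc ‖x - x₀‖ ≤ ‖x - u 0‖ + ‖u 0 - x₀‖ := norm_sub_le_norm_sub_add_norm_sub _ _ _
      _ ≤ ρ / 2 + (δ + r 0) := add_le_add h4 h2
      _ ≤ δ + ρ := by linarith
  · have hr0 : Tendsto r atTop (𝓝 0) := by
      have := (tendsto_pow_atTop_nhds_zero_of_lt_one (r := (2⁻¹ : ℝ)) (by norm_num)
        (by norm_num)).const_mul (ρ / 8)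
      simpa [r, div_eq_mul_inv] using this
    have h6 : Tendsto (fun k => z i - D.e i (u k)) atTop (𝓝 0) :=
      squeeze_zero_norm (fun k => (hu k).2 i hi) hr0
    have h7 := tendsto_nhds_unique h6
      (tendsto_const_nhds.sub (((D.e i).continuous.tendsto x).comp hx))
    exact (sub_eq_zero.1 h7.symm).symm

end EllOneBasis

namespace EllOneBasis

variable {𝕜 X : Type*} [RCLike 𝕜] [NormedAddCommGroup X] [NormedSpace 𝕜 X]

/-! ### Compact operators are approximated by coordinate partial sums -/

/-- The unit vectors of the bidual `ℓ∞` are weak-star limits of sequences in the unit ball. -/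
lemma exists_seq_tendsto_coef (D : EllOneBasis 𝕜 X) (i : ℕ) :
    ∃ u : ℕ → X, (∀ k, ‖u k‖ ≤ 1) ∧
      ∀ f : StrongDual 𝕜 X, Tendsto (fun k => f (u k)) atTop (𝓝 (D.coef i f)) := by
  have h : ∀ k : ℕ, ∃ u : X, ‖u‖ ≤ 1 ∧
      ∀ j < k, ‖(if i = j then 1 else 0) - D.e j u‖ ≤ 1 / ((k : ℝ) + 1) := by
    intro k
    obtain ⟨u, h1, -, h3⟩ := D.exists_approx_lift k (x₀ := 0)
      (z := fun j => if i = j then 1 else 0) (δ := 1) (by simp) zero_le_one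
      (fun j _ => by split_ifs <;> simp) (fun j _ => by split_ifs <;> simp)
      (Nat.one_div_pos_of_nat (α := ℝ) (n := k))
    exact ⟨u, h1, h3⟩
  choose u hu hue using h
  refine ⟨u, hu, fun f => ?_⟩
  have hlim : ∀ j, Tendsto (fun k => D.coef j f * D.e j (u k)) atTop
      (𝓝 (if j = i then D.coef j f else 0)) := by
    intro j
    have h0 : Tendsto (fun k => (if i = j then (1 : 𝕜) else 0) - D.e j (u k)) atTop (𝓝 0) := by
      refine squeeze_zero_norm' ?_ tendsto_one_div_add_atTop_nhds_zero_nat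
      filter_upwards [eventually_gt_atTop j] with k hk using hue k j hk
    have h1 := (tendsto_const_nhds (x := if i = j then (1 : 𝕜) else 0)).sub h0
    simp only [sub_sub_cancel, sub_zero] at h1
    convert h1.const_mul (D.coef j f) using 2
    simp [eq_comm]
  have := tendsto_tsum_of_dominated_convergence (D.hasSum_norm f).summable hlim
    (Eventually.of_forall fun k j => by
      rw [norm_mul]
      exact mul_le_of_le_one_right (norm_nonneg _) ((D.norm_e_apply_le j _).trans (hu k)))
  simpa only [(D.hasSum_apply f _).tsum_eq, tsum_ite_eq] using this

variable {Y : Type*} [NormedAddCommGroup Y] [NormedSpace 𝕜 Y]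

/-- The second adjoint of a compact operator maps the `i`-th unit vector of the bidual `ℓ∞` into
`Y`, rather than merely into the bidual of `Y`. -/
lemma exists_forall_apply_eq_coef (D : EllOneBasis 𝕜 X) {T : X →L[𝕜] Y}
    (hT : IsCompactOperator T) (i : ℕ) :
    ∃ y : Y, ∀ ψ : StrongDual 𝕜 Y, ψ y = D.coef i (ψ.comp T) := by
  obtain ⟨u, hu, hlim⟩ := D.exists_seq_tendsto_coef i
  obtain ⟨K, hK, hTK⟩ :=
    IsCompactOperator.image_closedBall_subset_compact (f := (T : X →ₗ[𝕜] Y)) hT 1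
  obtain ⟨y, -, s, hs, hy⟩ := hK.tendsto_subseq (x := fun k => T (u k))
    fun k => hTK ⟨u k, by simpa using hu k, rfl⟩
  exact ⟨y, fun ψ => tendsto_nhds_unique ((ψ.continuous.tendsto y).comp hy)
    ((hlim (ψ.comp T)).comp hs.tendsto_atTop)⟩

/-- The adjoint of a compact operator maps the unit ball to a totally bounded set. -/
lemma _root_.IsCompactOperator.exists_finset_dual_approx {T : X →L[𝕜] Y}
    (hT : IsCompactOperator T) {δ : ℝ} (hδ : 0 < δ) :
    ∃ F : Finset (StrongDual 𝕜 X), ∀ ψ : StrongDual 𝕜 Y, ‖ψ‖ ≤ 1 →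
      ∃ f ∈ F, ‖ψ.comp T - f‖ ≤ δ := by
  obtain ⟨K, hK, hTK⟩ :=
    IsCompactOperator.image_closedBall_subset_compact (f := (T : X →ₗ[𝕜] Y)) hT 1
  obtain ⟨t, -, ht, htK⟩ := hK.finite_cover_balls (e := δ / 4) (by positivity)
  have := ht.fintype
  -- a functional of norm at most one is determined, up to a small error, by its values on the net
  let A : Set (t → 𝕜) := (fun ψ : StrongDual 𝕜 Y => fun w : t => ψ w) '' Metric.closedBall 0 1
  have hA : TotallyBounded A := by
    let E : StrongDual 𝕜 Y →L[𝕜] (t → 𝕜) :=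
      ContinuousLinearMap.pi fun w : t => ContinuousLinearMap.apply 𝕜 𝕜 (w : Y)
    have hE : Bornology.IsBounded (E '' Metric.closedBall 0 1) :=
      E.lipschitz.isBounded_image Metric.isBounded_closedBall
    exact hE.isCompact_closure.totallyBounded.subset subset_closure
  obtain ⟨s, hsA, hs, hAs⟩ := Metric.finite_approx_of_totallyBounded hA (δ / 4) (by positivity)
  classical
  have hsA' : ∀ a ∈ s, ∃ ψ : StrongDual 𝕜 Y, ‖ψ‖ ≤ 1 ∧ ∀ w : t, ψ w = a w := fun a ha => by
    obtain ⟨ψ, hψ, rfl⟩ := hsA ha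
    exact ⟨ψ, by simpa using hψ, fun _ => rfl⟩
  choose! Ψ hΨ hΨs using hsA'
  refine ⟨hs.toFinset.image fun a => (Ψ a).comp T, fun ψ hψ => ?_⟩
  obtain ⟨a, ha, hψa⟩ := Set.mem_iUnion₂.1 (hAs ⟨ψ, by simpa using hψ, rfl⟩)
  refine ⟨(Ψ a).comp T, Finset.mem_image_of_mem _ (by simpa using ha), ?_⟩
  refine ContinuousLinearMap.opNorm_le_of_unit_norm hδ.le fun x hx => ?_
  obtain ⟨w, hw, hxw⟩ := Set.mem_iUnion₂.1 (htK (hTK ⟨x, by simp [hx], rfl⟩))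
  have h1 : ‖T x - w‖ ≤ δ / 4 := by simpa [dist_eq_norm] using (Metric.mem_ball.1 hxw).le
  have h2 : ‖ψ w - Ψ a w‖ ≤ δ / 4 := by
    have := (dist_le_pi_dist _ _ (⟨w, hw⟩ : t)).trans (Metric.mem_ball.1 hψa).le
    rwa [← hΨs a ha, dist_eq_norm] at this
  have h3 : ‖ψ - Ψ a‖ ≤ 2 := (norm_sub_le _ _).trans (by linarith [hΨ a ha])
  have h4 := (ψ - Ψ a).le_of_opNorm_le h3 (T x - w)
  calc ‖(ψ.comp T - (Ψ a).comp T) x‖ = ‖(ψ - Ψ a) (T x - w) + (ψ w - Ψ a w)‖ := by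
        congr 1; simp only [ContinuousLinearMap.comp_apply, _root_.sub_apply, map_sub]; abel
    _ ≤ 2 * (δ / 4) + δ / 4 := (norm_add_le _ _).trans (add_le_add (h4.trans (by linarith)) h2)
    _ ≤ δ := by linarith

/-- Partial sums of the basis expansion converge uniformly on the image of the dual unit ball under
the adjoint of a compact operator. -/
lemma exists_forall_norm_sub_sum_coef_le (D : EllOneBasis 𝕜 X) {T : X →L[𝕜] Y}
    (hT : IsCompactOperator T) {δ : ℝ} (hδ : 0 < δ) :
    ∃ n, ∀ ψ : StrongDual 𝕜 Y, ‖ψ‖ ≤ 1 →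
      ‖ψ.comp T - ∑ i ∈ Finset.range n, D.coef i (ψ.comp T) • D.e i‖ ≤ δ := by
  obtain ⟨F, hF⟩ := hT.exists_finset_dual_approx (δ := δ / 4) (by positivity)
  have hlim : ∀ f ∈ F, ∀ᶠ n in atTop,
      ‖f - ∑ i ∈ Finset.range n, D.coef i f • D.e i‖ ≤ δ / 2 := by
    intro f _
    have h := ((D.hasSum f).tendsto_sum_nat.const_sub f).norm
    rw [sub_self, norm_zero] at h
    exact h.eventually_le_const (by positivity)
  obtain ⟨n, hn⟩ := ((Filter.eventually_all_finset F).2 hlim).exists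
  refine ⟨n, fun ψ hψ => ?_⟩
  obtain ⟨f, hf, hψf⟩ := hF ψ hψ
  generalize (ψ.comp T : StrongDual 𝕜 X) = g at hψf ⊢
  have h1 : ‖∑ i ∈ Finset.range n, D.coef i (g - f) • D.e i‖ ≤ ‖g - f‖ := by
    refine (norm_sum_le_of_le _ fun i _ => ?_).trans (D.sum_norm_coef_le (g - f) (Finset.range n))
    rw [norm_smul]
    exact mul_le_of_le_one_right (norm_nonneg _) (D.norm_e_le i)
  have h2 : g - ∑ i ∈ Finset.range n, D.coef i g • D.e i =
      (g - f) - ∑ i ∈ Finset.range n, D.coef i (g - f) • D.e i +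
        (f - ∑ i ∈ Finset.range n, D.coef i f • D.e i) := by
    have h3 : ∀ i, D.coef i (g - f) • D.e i = D.coef i g • D.e i - D.coef i f • D.e i :=
      fun i => by rw [map_sub]; exact sub_smul (D.coef i g) (D.coef i f) (D.e i)
    rw [Finset.sum_congr rfl fun i _ => h3 i, Finset.sum_sub_distrib]
    abel
  rw [h2]
  refine (norm_add_le_of_le (norm_sub_le_of_le hψf (h1.trans hψf)) (hn f hf)).trans ?_
  linarith

/-- A compact operator on `X` is approximated by operators depending only on finitely many of the
coordinates `e i`. -/
lemma exists_norm_sub_sum_le (D : EllOneBasis 𝕜 X) {T : X →L[𝕜] Y}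
    (hT : IsCompactOperator T) {δ : ℝ} (hδ : 0 < δ) :
    ∃ (n : ℕ) (y : ℕ → Y), ∀ x, ‖T x - ∑ i ∈ Finset.range n, D.e i x • y i‖ ≤ δ * ‖x‖ := by
  choose y hy using D.exists_forall_apply_eq_coef hT
  obtain ⟨n, hn⟩ := D.exists_forall_norm_sub_sum_coef_le hT hδ
  refine ⟨n, y, fun x => ?_⟩
  obtain ⟨ψ, hψ, hψx⟩ := exists_dual_vector'' 𝕜 (T x - ∑ i ∈ Finset.range n, D.e i x • y i)
  have h := (ψ.comp T - ∑ i ∈ Finset.range n, D.coef i (ψ.comp T) • D.e i).le_of_opNorm_le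
    (hn ψ hψ) x
  have h2 : (ψ.comp T - ∑ i ∈ Finset.range n, D.coef i (ψ.comp T) • D.e i) x =
      ψ (T x - ∑ i ∈ Finset.range n, D.e i x • y i) := by
    simp [hy, mul_comm]
  rwa [h2, hψx, RCLike.norm_ofReal, abs_norm] at h

end EllOneBasis

/-! ### Operators into and out of `c₀` -/

namespace CZero

variable {𝕜 X : Type*} [RCLike 𝕜] [NormedAddCommGroup X] [NormedSpace 𝕜 X]

lemma norm_apply_le (c : CZero 𝕜) (i : ℕ) : ‖c i‖ ≤ ‖c‖ :=
  c.toBCF.norm_coe_le_norm i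

lemma norm_le {c : CZero 𝕜} {r : ℝ} (hr : 0 ≤ r) (h : ∀ i, ‖c i‖ ≤ r) : ‖c‖ ≤ r :=
  (BoundedContinuousFunction.norm_le hr (f := c.toBCF)).2 h

lemma tendsto_zero (c : CZero 𝕜) : Tendsto c atTop (𝓝 0) := by
  have := c.zero_at_infty'
  rwa [cocompact_eq_cofinite, Nat.cofinite_eq_atTop] at this

/-- The `i`-th coordinate functional on `c₀`. -/
noncomputable def eval (𝕜 : Type*) [RCLike 𝕜] (i : ℕ) : CZero 𝕜 →L[𝕜] 𝕜 :=
  LinearMap.mkContinuous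
    { toFun := fun c => c i
      map_add' := fun _ _ => rfl
      map_smul' := fun _ _ => rfl } 1 fun c => by simpa using norm_apply_le c i

@[simp] lemma eval_apply (i : ℕ) (c : CZero 𝕜) : eval 𝕜 i c = c i := rfl

/-- The contraction into `c₀` whose coordinates are the given functionals of norm at most one,
which are required to tend to zero in norm. -/
noncomputable def ofFunctionals (g : ℕ → StrongDual 𝕜 X) (hg : ∀ i, ‖g i‖ ≤ 1)
    (hg0 : Tendsto g atTop (𝓝 0)) : X →L[𝕜] CZero 𝕜 :=
  LinearMap.mkContinuous
    { toFun := fun x =>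
        { toFun := fun i => g i x
          continuous_toFun := continuous_of_discreteTopology
          zero_at_infty' := by
            rw [cocompact_eq_cofinite, Nat.cofinite_eq_atTop]
            exact ((ContinuousLinearMap.apply 𝕜 𝕜 x).continuous.tendsto' 0 0 (by simp)).comp hg0 }
      map_add' := fun _ _ => by ext; simp
      map_smul' := fun _ _ => by ext; simp } 1 fun x => by
        rw [one_mul]
        exact norm_le (norm_nonneg x) fun i => by
          simpa using (g i).le_of_opNorm_le (hg i) x

@[simp] lemma ofFunctionals_apply (g : ℕ → StrongDual 𝕜 X) (hg : ∀ i, ‖g i‖ ≤ 1)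
    (hg0 : Tendsto g atTop (𝓝 0)) (x : X) (i : ℕ) : ofFunctionals g hg hg0 x i = g i x := rfl

lemma norm_ofFunctionals_le (g : ℕ → StrongDual 𝕜 X) (hg : ∀ i, ‖g i‖ ≤ 1)
    (hg0 : Tendsto g atTop (𝓝 0)) : ‖ofFunctionals g hg hg0‖ ≤ 1 :=
  LinearMap.mkContinuous_norm_le _ zero_le_one _

/-- The supremum norm on `c₀` is attained. -/
lemma exists_norm_apply_eq {c : CZero 𝕜} (hc : ‖c‖ = 1) : ∃ i, ‖c i‖ = 1 := by
  by_contra! h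
  have hlt : ∀ i, ‖c i‖ < 1 := fun i => lt_of_le_of_ne ((norm_apply_le c i).trans_eq hc) (h i)
  obtain ⟨N, hN⟩ := eventually_atTop.1
    (((tendsto_zero c).norm.eventually_le_const (u := 1 / 2) (by simp)))
  -- beyond `N` the entries are at most `1 / 2`, and only finitely many remain
  obtain ⟨r, hr1, hr⟩ : ∃ r < (1 : ℝ), ∀ i < N, ‖c i‖ ≤ r := by
    clear hN
    induction N with
    | zero => exact ⟨0, one_pos, by simp⟩
    | succ N ih =>
      obtain ⟨r, hr1, hr⟩ := ih
      refine ⟨max r ‖c N‖, max_lt hr1 (hlt N), fun i hi => ?_⟩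
      rcases Nat.lt_succ_iff_lt_or_eq.1 hi with hi | rfl
      · exact (hr i hi).trans (le_max_left _ _)
      · exact le_max_right _ _
  have : ‖c‖ ≤ max r (1 / 2) := by
    refine norm_le (le_max_of_le_right (by norm_num)) fun i => ?_
    rcases lt_or_ge i N with hi | hi
    · exact (hr i hi).trans (le_max_left _ _)
    · exact (hN i hi).trans (le_max_right _ _)
  rw [hc] at this
  exact absurd this (not_le.2 (max_lt hr1 (by norm_num)))

end CZero

/-! ### The Bishop–Phelps–Bollobás property without normalisation -/

lemma RCLike.norm_inv_norm_smul_sub {𝕜 E : Type*} [RCLike 𝕜] [NormedAddCommGroup E]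
    [NormedSpace 𝕜 E] {v : E} (hv : v ≠ 0) : ‖(‖v‖ : 𝕜)⁻¹ • v - v‖ = |1 - ‖v‖| := by
  have hv' : ‖v‖ ≠ 0 := norm_ne_zero_iff.2 hv
  have h : (‖v‖ : 𝕜)⁻¹ • v - v = ((‖v‖⁻¹ - 1 : ℝ) : 𝕜) • v := by
    push_cast
    rw [sub_smul, one_smul]
  rw [h, norm_smul, RCLike.norm_ofReal, ← abs_norm v, ← abs_mul, abs_norm, sub_mul,
    inv_mul_cancel₀ hv', one_mul]

/-- In the Bishop–Phelps–Bollobás property the operator and the point need only be almost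
normalised. -/
lemma HasBPBpCompact.exists_of_norm_le {𝕜 E Y : Type*} [RCLike 𝕜] [NormedAddCommGroup E]
    [NormedSpace 𝕜 E] [NormedAddCommGroup Y] [NormedSpace 𝕜 Y] (h : HasBPBpCompact 𝕜 E Y)
    {ε : ℝ} (hε : 0 < ε) :
    ∃ δ : ℝ, 0 < δ ∧ ∀ U : E →L[𝕜] Y, IsCompactOperator U → ‖U‖ ≤ 1 + δ →
      ∀ z₀ : E, ‖z₀‖ ≤ 1 → 1 - δ < ‖U z₀‖ →
        ∃ S : E →L[𝕜] Y, IsCompactOperator S ∧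
          ∃ w : E, ‖w‖ = 1 ∧ ‖S‖ = 1 ∧ ‖S w‖ = 1 ∧ ‖z₀ - w‖ < ε ∧ ‖S - U‖ < ε := by
  obtain ⟨η, hη, H⟩ := h (ε / 2) (by positivity)
  obtain ⟨δ, hδ, hδη, hδε, hδ1⟩ : ∃ δ : ℝ, 0 < δ ∧ 2 * δ ≤ η ∧ 4 * δ ≤ ε ∧ 4 * δ ≤ 1 := by
    refine ⟨min (η / 2) (min (ε / 4) (1 / 4)), by positivity, ?_, ?_, ?_⟩
    · linarith [min_le_left (η / 2) (min (ε / 4) (1 / 4))]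
    · linarith [min_le_right (η / 2) (min (ε / 4) (1 / 4)), min_le_left (ε / 4) (1 / 4)]
    · linarith [min_le_right (η / 2) (min (ε / 4) (1 / 4)), min_le_right (ε / 4) (1 / 4)]
  refine ⟨δ, hδ, fun U hUc hUle z₀ hz₀le hUz₀ => ?_⟩
  have hUge : 1 - δ < ‖U‖ := hUz₀.trans_le (by simpa using U.le_opNorm_of_le hz₀le)
  have hz₀ge : 1 - 2 * δ ≤ ‖z₀‖ := by
    by_contra! hlt
    have h1 := U.le_opNorm z₀
    have h2 : ‖U‖ * ‖z₀‖ ≤ (1 + δ) * (1 - 2 * δ) := by gcongr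
    nlinarith
  have hUpos : 0 < ‖U‖ := by linarith
  have hz₀pos : 0 < ‖z₀‖ := by linarith
  have hU0 : U ≠ 0 := norm_pos_iff.1 hUpos
  have hz₀0 : z₀ ≠ 0 := norm_pos_iff.1 hz₀pos
  have hVU : ‖(‖U‖ : 𝕜)⁻¹ • U - U‖ ≤ δ := by
    rw [RCLike.norm_inv_norm_smul_sub hU0, abs_le]
    constructor <;> linarith
  have hzz₀ : ‖(‖z₀‖ : 𝕜)⁻¹ • z₀ - z₀‖ ≤ 2 * δ := by
    rw [RCLike.norm_inv_norm_smul_sub hz₀0, abs_le]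
    constructor <;> linarith
  have hVz : 1 - η < ‖((‖U‖ : 𝕜)⁻¹ • U) ((‖z₀‖ : 𝕜)⁻¹ • z₀)‖ := by
    have h1 : ‖((‖U‖ : 𝕜)⁻¹ • U) ((‖z₀‖ : 𝕜)⁻¹ • z₀)‖ = ‖U‖⁻¹ * (‖z₀‖⁻¹ * ‖U z₀‖) := by
      simp only [map_smul, _root_.smul_apply, norm_smul, norm_inv, RCLike.norm_ofReal, abs_norm]
      ring
    have h2 : ‖U z₀‖ ≤ ‖z₀‖⁻¹ * ‖U z₀‖ :=
      le_mul_of_one_le_left (norm_nonneg _) ((one_le_inv₀ hz₀pos).2 hz₀le)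
    have h3 : (1 - 2 * δ) * ‖U‖ ≤ (1 - 2 * δ) * (1 + δ) :=
      mul_le_mul_of_nonneg_left hUle (by linarith)
    have h4 : (1 - η) * ‖U‖ ≤ (1 - 2 * δ) * ‖U‖ :=
      mul_le_mul_of_nonneg_right (by linarith) hUpos.le
    rw [h1, inv_mul_eq_div, lt_div_iff₀ hUpos]
    nlinarith
  obtain ⟨S, hSc, w, hw, hS, hSw, hzw, hSV⟩ :=
    H _ (hUc.smul _) (norm_smul_inv_norm hU0) _ (norm_smul_inv_norm hz₀0) hVz
  refine ⟨S, hSc, w, hw, hS, hSw, ?_, ?_⟩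
  · have := norm_sub_le_norm_sub_add_norm_sub z₀ ((‖z₀‖ : 𝕜)⁻¹ • z₀) w
    rw [norm_sub_rev z₀ ((‖z₀‖ : 𝕜)⁻¹ • z₀)] at this
    linarith
  · linarith [norm_sub_le_norm_sub_add_norm_sub S ((‖U‖ : 𝕜)⁻¹ • U) U]

/-! ### Transfer of the Bishop–Phelps–Bollobás property -/

namespace EllOneBasis

variable {𝕜 X : Type*} [RCLike 𝕜] [NormedAddCommGroup X] [NormedSpace 𝕜 X]

/-- The first `n` coordinates of a point of `X`, as an element of `c₀`. -/
noncomputable def truncation (D : EllOneBasis 𝕜 X) (n : ℕ) : X →L[𝕜] CZero 𝕜 :=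
  CZero.ofFunctionals (fun i => if i < n then D.e i else 0)
    (fun i => by split_ifs <;> simp [D.norm_e_le])
    (tendsto_const_nhds.congr' <| by
      filter_upwards [eventually_ge_atTop n] with i hi using (if_neg hi.not_gt).symm)

@[simp] lemma truncation_apply (D : EllOneBasis 𝕜 X) (n : ℕ) (x : X) (i : ℕ) :
    D.truncation n x i = if i < n then D.e i x else 0 := by
  simp only [truncation, CZero.ofFunctionals_apply]
  split_ifs <;> simp

lemma norm_truncation_le (D : EllOneBasis 𝕜 X) (n : ℕ) : ‖D.truncation n‖ ≤ 1 :=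
  CZero.norm_ofFunctionals_le _ _ _

/-- If `w` in the unit sphere of `c₀` has an entry of modulus one among the first `n`, then some
contraction `X → c₀` extending the first `n` coordinates takes the value `w` at every point of `X`
having the same first `n` coordinates as `w`. -/
lemma exists_contraction_apply_eq (D : EllOneBasis 𝕜 X) (n : ℕ) {w : CZero 𝕜} (hw : ‖w‖ = 1)
    {j : ℕ} (hj : j < n) (hwj : ‖w j‖ = 1) :
    ∃ L : X →L[𝕜] CZero 𝕜, ‖L‖ ≤ 1 ∧ (∀ x, ∀ i < n, L x i = D.e i x) ∧
      ∀ x, (∀ i < n, D.e i x = w i) → L x = w := by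
  -- fill the missing coordinates by the multiple `conj (w j) * e j x` of those of `w`
  have hnorm : ∀ i, ‖(star (w j) * w i) • D.e j‖ ≤ 1 := fun i => by
    rw [norm_smul, norm_mul, norm_star, hwj, one_mul]
    exact mul_le_one₀ ((CZero.norm_apply_le w i).trans_eq hw) (norm_nonneg _) (D.norm_e_le j)
  have hlim : Tendsto (fun i => if i < n then D.e i else (star (w j) * w i) • D.e j) atTop
      (𝓝 0) := by
    have h : Tendsto (fun i => (star (w j) * w i) • D.e j) atTop (𝓝 0) := by
      have h := ((CZero.tendsto_zero w).const_mul (star (w j))).smul_const (D.e j)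
      rw [mul_zero] at h
      exact h.trans_eq (by rw [zero_smul 𝕜 (D.e j)])
    refine h.congr' ?_
    filter_upwards [eventually_ge_atTop n] with i hi using (if_neg hi.not_gt).symm
  refine ⟨CZero.ofFunctionals (fun i => if i < n then D.e i else (star (w j) * w i) • D.e j)
    (fun i => ?_) hlim, CZero.norm_ofFunctionals_le _ _ _, fun x i hi => ?_, fun x hx => ?_⟩
  · split_ifs
    exacts [D.norm_e_le i, hnorm i]
  · simp [hi]
  · ext i
    rw [CZero.ofFunctionals_apply]
    split_ifs with hi
    · exact hx i hi
    · have h : star (w j) * w j = 1 := by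
        rw [RCLike.star_def, RCLike.conj_mul, hwj]; simp
      rw [_root_.smul_apply, hx j hj, smul_eq_mul]
      linear_combination w i * h

end EllOneBasis

theorem mainTheorem2 (𝕜 : Type*) [RCLike 𝕜]
    (X : Type*) [NormedAddCommGroup X] [NormedSpace 𝕜 X] [CompleteSpace X]
    (Y : Type*) [NormedAddCommGroup Y] [NormedSpace 𝕜 Y] [CompleteSpace Y]
    (hX : Nonempty (StrongDual 𝕜 X ≃ₗᵢ[𝕜] EllOne 𝕜))
    (hY : HasBPBpCompact 𝕜 (CZero 𝕜) Y) :
    HasBPBpCompact 𝕜 X Y := by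
  obtain ⟨φ⟩ := hX
  obtain ⟨D⟩ := EllOneBasis.nonempty_of_linearIsometryEquiv φ
  intro ε hε
  obtain ⟨η, hη, H⟩ := hY.exists_of_norm_le (ε := min (ε / 2) 1) (by positivity)
  obtain ⟨δ, hδ, hδη, hδε⟩ : ∃ δ : ℝ, 0 < δ ∧ 2 * δ ≤ η ∧ 4 * δ ≤ ε := by
    refine ⟨min (η / 2) (ε / 4), by positivity, ?_, ?_⟩
    · linarith [min_le_left (η / 2) (ε / 4)]
    · linarith [min_le_right (η / 2) (ε / 4)]
  refine ⟨δ, hδ, fun T hT hT1 x₀ hx₀ hTx₀ => ?_⟩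
  obtain ⟨n, y, hy⟩ := D.exists_norm_sub_sum_le hT hδ
  -- the operator on `c₀` obtained from the approximation of `T`
  let U : CZero 𝕜 →L[𝕜] Y := ∑ i ∈ Finset.range n, (CZero.eval 𝕜 i).smulRight (y i)
  have hU : ∀ c, U c = ∑ i ∈ Finset.range n, c i • y i := fun c => by
    simp [U]
  have hUE : ∀ (x : X) (c : CZero 𝕜), (∀ i < n, c i = D.e i x) →
      ‖T x - U c‖ ≤ δ * ‖x‖ := fun x c h => by
    rw [hU, Finset.sum_congr rfl fun i hi => by rw [h i (Finset.mem_range.1 hi)]]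
    exact hy x
  have hUcomp : IsCompactOperator U := by
    exact (compactOperator (RingHom.id 𝕜) (CZero 𝕜) Y).sum_mem fun i _ =>
      (isCompactOperator_of_locallyCompactSpace_rng
        (ContinuousLinearMap.toSpanSingleton 𝕜 (y i))).comp_clm (CZero.eval 𝕜 i)
  -- every point of the unit ball of `c₀` has, up to coordinate `n`, a preimage in that of `X`
  have hUle : ‖U‖ ≤ 1 + δ := by
    refine ContinuousLinearMap.opNorm_le_of_unit_norm (by positivity) fun c hc => ?_
    obtain ⟨x, hx, -, hxc⟩ := D.exists_lift n (x₀ := 0) (z := c) (δ := 1) (by simp) zero_le_one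
      (fun i _ => (CZero.norm_apply_le c i).trans_eq hc)
      (fun i _ => by simpa using (CZero.norm_apply_le c i).trans_eq hc) one_pos
    have h1 := hUE x c fun i hi => (hxc i hi).symm
    have h2 := T.le_of_opNorm_le hT1.le x
    have h3 : δ * ‖x‖ ≤ δ := mul_le_of_le_one_right hδ.le hx
    linarith [norm_sub_norm_le (U c) (T x), norm_sub_rev (U c) (T x)]
  set z₀ : CZero 𝕜 := D.truncation n x₀ with hz₀
  have hz₀i : ∀ i < n, z₀ i = D.e i x₀ := fun i hi => by simp [hz₀, hi]
  have hz₀le : ‖z₀‖ ≤ 1 := by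
    simpa [hx₀] using (D.truncation n).le_of_opNorm_le (D.norm_truncation_le n) x₀
  have hUz₀ : 1 - 2 * δ < ‖U z₀‖ := by
    have h1 := hUE x₀ z₀ hz₀i
    rw [hx₀] at h1
    linarith [norm_sub_norm_le (T x₀) (U z₀)]
  obtain ⟨S₀, hS₀c, w, hw, hS₀, hS₀w, hzw, hS₀U⟩ :=
    H U hUcomp (by linarith) z₀ hz₀le (by linarith)
  have hzw1 := hzw.trans_le (min_le_left _ _)
  have hzw2 := hzw.trans_le (min_le_right _ _)
  obtain ⟨j, hwj⟩ := CZero.exists_norm_apply_eq hw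
  -- from `n` on the entries of `z₀` vanish, so those of `w` have modulus less than one
  have hj : j < n := by
    by_contra h
    have h1 := CZero.norm_apply_le (z₀ - w) j
    have h2 : (z₀ - w) j = -w j := by simp [hz₀, h]
    rw [h2, norm_neg, hwj] at h1
    linarith
  obtain ⟨L, hL, hLi, hLw⟩ := D.exists_contraction_apply_eq n hw hj hwj
  have hdist : ∀ i < n, ‖w i - D.e i x₀‖ ≤ ε / 2 := fun i hi => by
    rw [← hz₀i i hi, norm_sub_rev]
    exact (CZero.norm_apply_le (z₀ - w) i).trans hzw1.le
  obtain ⟨x₁, hx₁, hx₁x₀, hx₁w⟩ := D.exists_lift n hx₀.le (z := w) (by positivity)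
    (fun i _ => (CZero.norm_apply_le w i).trans_eq hw) hdist hδ
  have hSx₁ : ‖(S₀.comp L) x₁‖ = 1 := by
    rw [ContinuousLinearMap.comp_apply, hLw x₁ hx₁w, hS₀w]
  have hSle : ‖S₀.comp L‖ ≤ 1 :=
    (S₀.opNorm_comp_le L).trans (by rw [hS₀, one_mul]; exact hL)
  have hSx₁le := (S₀.comp L).le_of_opNorm_le hSle x₁
  have hx₁1 : ‖x₁‖ = 1 := le_antisymm hx₁ (by linarith)
  refine ⟨S₀.comp L, hS₀c.comp_clm L, x₁, hx₁1, le_antisymm hSle ?_, hSx₁, ?_, ?_⟩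
  · have := (S₀.comp L).le_opNorm x₁
    rwa [hSx₁, hx₁1, mul_one] at this
  · rw [norm_sub_rev]
    linarith
  · have hUT : ‖U.comp L - T‖ ≤ δ :=
      ContinuousLinearMap.opNorm_le_bound _ hδ.le fun x => by
        rw [← norm_neg]
        simpa using hUE x (L x) (hLi x)
    have h1 : ‖(S₀ - U).comp L‖ ≤ ‖S₀ - U‖ :=
      ((S₀ - U).opNorm_comp_le L).trans (mul_le_of_le_one_right (norm_nonneg _) hL)
    have h2 : S₀.comp L - T = (S₀ - U).comp L + (U.comp L - T) := by
      rw [ContinuousLinearMap.sub_comp]; abel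
    rw [h2]
    linarith [norm_add_le ((S₀ - U).comp L) (U.comp L - T), hS₀U.trans_le (min_le_left _ _)]
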